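/- Let $A$ be an Artin algebra, i.e. an algebra over a commutative artinian ring $R$ that is finitely generated as an $R$-module; let $n\ge 2$, $r\ge 0$, and let $T_n(A)$ be the $R$-algebra of upper triangular $n\times n$ matrices over $A$. Modules are finitely generated left modules. Write $D=\operatorname{Hom}_R(-,E)$, with $E$ the injective envelope of $R/\operatorname{rad}R$, so that $D(A_A)$ is a left $A$-module via $(af)(x)=f(xa)$. An $A$-module $T$ is called $r$-cotilting if (i) $\operatorname{inj.dim}T\le r$; (ii) $\operatorname{Ext}^i_A(T,T)=0$ for all $i\ge 1$; and (iii) for some $s\ge 0$ there is an exact sequence $0\to T_s\to\cdots\to T_0\to D(A_A)\to 0$ in which every $T_i$ is a direct summand of a finite direct sum of copies of $T$. The same definition, with the same $R$ and $E$, is used for $T_n(A)$-modules. For an $A$-module $M$ and $1\le i\le n$ let $\mathbf m_i(M)$ be the $T_n(A)$-module of columns $(x_1,\dots,x_i,0,\dots,0)^{t}$ with $x_j\in M$, on which $T_n(A)$ acts by matrix multiplication, and let $\mathbf m(M)=\mathbf m_1(M)\oplus\cdots\oplus\mathbf m_n(M)$. **Lemma 3.7.** If $T$ is an $r$-cotilting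 $A$-module, then $\mathbf m(T)$ is an $(r+1)$-cotilting $T_n(A)$-module. Moreover, there is an isomorphism of $R$-algebras $$\operatorname{End}_{T_n(A)}(\mathbf m(T))\;\cong\;T_n(\operatorname{End}_A(T)),$$ where the product in both endomorphism rings is the usual composition of maps, $(fg)(x)=f(g(x))$. -/

import Mathlib

open CategoryTheory

universe u

/-- `T_n(A)`: the algebra of upper triangular `n × n` matrices over the `R`-algebra `A`. -/
def UpperTriangular (R : Type u) (n : ℕ) (A : Type u) [CommRing R] [Ring A] [Algebra R A] :
    Subalgebra R (Matrix (Fin n) (Fin n) A) where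
  carrier := {a | ∀ i j, j < i → a i j = 0}
  mul_mem' := by
    intro a b ha hb i j hij
    rw [Matrix.mul_apply]
    refine Finset.sum_eq_zero fun k _ => ?_
    rcases lt_or_ge k i with hk | hk
    · rw [ha i k hk, zero_mul]
    · rw [hb k j (lt_of_lt_of_le hij hk), mul_zero]
  add_mem' := by
    intro a b ha hb i j hij
    rw [Matrix.add_apply, ha i j hij, hb i j hij, add_zero]
  algebraMap_mem' := by
    intro r i j hij
    rw [Matrix.algebraMap_matrix_apply, if_neg hij.ne']

section Columns

/-- Column vectors of length `n` with entries in `M`. -/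
def Column (n : ℕ) (M : Type u) : Type u := Fin n → M

instance (n : ℕ) (M : Type u) [AddCommGroup M] : AddCommGroup (Column n M) :=
  inferInstanceAs (AddCommGroup (Fin n → M))

/-- Matrices act on columns by matrix multiplication, `(a x)_i = ∑ j, a_{ij} x_j`. -/
instance (n : ℕ) (A M : Type u) [Ring A] [AddCommGroup M] [Module A M] :
    Module (Matrix (Fin n) (Fin n) A) (Column n M) :=
  Matrix.Module.matrixModule

/-- Scalars act on columns entrywise. -/
instance (R : Type u) (n : ℕ) (M : Type u) [CommRing R] [AddCommGroup M] [Module R M] :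
    Module R (Column n M) :=
  inferInstanceAs (Module R (Fin n → M))

instance (R : Type u) (n : ℕ) (A M : Type u) [CommRing R] [Ring A] [Algebra R A]
    [AddCommGroup M] [Module A M] [Module R M] [IsScalarTower R A M] :
    IsScalarTower R (Matrix (Fin n) (Fin n) A) (Column n M) where
  smul_assoc r a x := by
    funext i
    change ∑ j, (r • a) i j • x j = r • ∑ j, a i j • x j
    simp only [Matrix.smul_apply, smul_assoc, Finset.smul_sum]

instance (R : Type u) (n : ℕ) (A M : Type u) [CommRing R] [Ring A] [Algebra R A]
    [AddCommGroup M] [Module A M] [Module R M] [IsScalarTower R A M] :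
    IsScalarTower R (UpperTriangular R n A) (Column n M) where
  smul_assoc r a x := smul_assoc r (a : Matrix (Fin n) (Fin n) A) x

end Columns

/-- The `T_n(A)`-module `m_i(M)` of all columns `(x_1, …, x_i, 0, …, 0)` with entries in `M`, acted
on by matrix multiplication: its branches are `M` in the rows `j ≤ i` and `0` in the rows `j > i`,
and the structure map from row `j + 1` to row `j` (the action of the matrix unit `e_{j,j+1}`) is the
identity of `M` for `j < i` and `0` for `j ≥ i`. Rows are numbered from `0` here. -/
def mBranch (R : Type u) (n : ℕ) (A M : Type u) [CommRing R] [Ring A] [Algebra R A]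
    [AddCommGroup M] [Module A M] (i : Fin n) :
    Submodule (UpperTriangular R n A) (Column n M) where
  carrier := {x | ∀ j, i < j → x j = 0}
  add_mem' := by
    intro x y hx hy j hj
    change x j + y j = 0
    rw [hx j hj, hy j hj, add_zero]
  zero_mem' := fun _ _ => rfl
  smul_mem' := by
    intro a x hx j hj
    change ∑ k, (a : Matrix (Fin n) (Fin n) A) j k • x k = 0
    refine Finset.sum_eq_zero fun k _ => ?_
    rcases lt_or_ge k j with hk | hk
    · rw [a.2 j k hk, zero_smul]
    · rw [hx k (lt_of_lt_of_le hj hk), smul_zero]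

/-- The `T_n(A)`-module `m(M) = m_1(M) ⊕ ⋯ ⊕ m_n(M)`. -/
abbrev MSum (R : Type u) (n : ℕ) (A M : Type u) [CommRing R] [Ring A] [Algebra R A]
    [AddCommGroup M] [Module A M] : Type u :=
  (i : Fin n) → mBranch R n A M i

/-- The underlying set `Hom_R(A, E)` of the dual of the right regular module `A_A`. -/
def DualRegular (R A E : Type u) [CommRing R] [Ring A] [Algebra R A] [AddCommGroup E]
    [Module R E] : Type u := A →ₗ[R] E

instance (R A E : Type u) [CommRing R] [Ring A] [Algebra R A] [AddCommGroup E] [Module R E] :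
    AddCommGroup (DualRegular R A E) :=
  inferInstanceAs (AddCommGroup (A →ₗ[R] E))

/-- The left `A`-module structure of the dual of `A_A`: `(a f)(x) = f(x a)`. -/
instance (R A E : Type u) [CommRing R] [Ring A] [Algebra R A] [AddCommGroup E] [Module R E] :
    Module A (DualRegular R A E) where
  smul a f := LinearMap.comp (show A →ₗ[R] E from f) (LinearMap.mulRight R a)
  one_smul f := LinearMap.ext fun x => congrArg (show A →ₗ[R] E from f) (mul_one x)
  mul_smul a b f := LinearMap.ext fun x =>
    congrArg (show A →ₗ[R] E from f) (mul_assoc x a b).symm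
  smul_zero _ := LinearMap.ext fun _ => rfl
  smul_add _ _ _ := LinearMap.ext fun _ => rfl
  add_smul a b f := LinearMap.ext fun x =>
    (congrArg (show A →ₗ[R] E from f) (mul_add x a b)).trans
      (map_add (show A →ₗ[R] E from f) (x * a) (x * b))
  zero_smul f := LinearMap.ext fun x =>
    (congrArg (show A →ₗ[R] E from f) (mul_zero x)).trans (map_zero (show A →ₗ[R] E from f))

/-- `E` is an injective envelope of the `R`-module `S`: it is injective and contains a copy of `S`
as an essential submodule. -/
def IsInjectiveEnvelope (R S E : Type u) [CommRing R] [AddCommGroup S] [Module R S]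
    [AddCommGroup E] [Module R E] : Prop :=
  Module.Injective R E ∧ ∃ ι : S →ₗ[R] E, Function.Injective ι ∧
    ∀ N : Submodule R E, N ⊓ LinearMap.range ι = ⊥ → N = ⊥

/-- `X ∈ add(T)`: `X` is a direct summand of a finite direct sum of copies of `T`. -/
def IsInAdd (A T X : Type u) [Ring A] [AddCommGroup T] [Module A T] [AddCommGroup X]
    [Module A X] : Prop :=
  ∃ (m : ℕ) (i : X →ₗ[A] (Fin m → T)) (p : (Fin m → T) →ₗ[A] X), p ∘ₗ i = LinearMap.id

/-- There is an exact sequence `0 → T_s → ⋯ → T_0 → D → 0` with all `T_i ∈ add(T)`. The sequence is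
continued by `T_i = 0` for `i > s`, so that exactness at `T_s` is injectivity of `T_s → T_{s-1}`
(of `T_0 → D` if `s = 0`). -/
def HasAddResolution (A T D : Type u) [Ring A] [AddCommGroup T] [Module A T] [AddCommGroup D]
    [Module A D] : Prop :=
  ∃ (s : ℕ) (X : ℕ → ModuleCat.{u} A) (d : ∀ i, X (i + 1) →ₗ[A] X i) (ε : X 0 →ₗ[A] D),
    (∀ i ≤ s, IsInAdd A T (X i)) ∧ (∀ i, s < i → Subsingleton (X i)) ∧
    Function.Surjective ε ∧ Function.Exact (d 0) ε ∧
    ∀ i, Function.Exact (d (i + 1)) (d i)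

/-- `T` is an `r`-cotilting module over the Artin `R`-algebra `A`: a finitely generated left
`A`-module of injective dimension at most `r`, without self-extensions, such that the dual
`D(A_A)` has a finite resolution by modules in `add(T)`. Here `D = Hom_R(-, E)`, where `E` is the
injective envelope of `R / rad R` (unique up to isomorphism). -/
structure IsCotilting (R A : Type u) [CommRing R] [Ring A] [Algebra R A] (r : ℕ)
    (T : Type u) [AddCommGroup T] [Module A T] : Prop where
  finite : Module.Finite A T
  injDim_le : HasInjectiveDimensionLE (ModuleCat.of A T) r
  ext_self : ∀ i : ℕ, 1 ≤ i →
    Subsingleton (Abelian.Ext.{u} (ModuleCat.of A T) (ModuleCat.of A T) i)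
  resolution : ∃ (E : Type u) (_ : AddCommGroup E) (_ : Module R E),
    IsInjectiveEnvelope R (R ⧸ Ring.jacobson R) E ∧ HasAddResolution A T (DualRegular R A E)

/-! Write B for the triangular matrix algebra and Col(M) for the B-module of all columns, which is
m_n(M). Let `resDiag` be restriction along the scalar matrices A → B. It has a left adjoint, M ↦
m(M), since m(M) is B ⊗_A M split by the columns of B, and a right adjoint, coinduction. Both
adjoints are well behaved because B is free over A on the matrix units.

Self-extensions: Ext_B(m(T), m(T)) is governed by Ext_A(T, res m(T)), and res m(T) is a finite sum
of copies of T (`subsingleton_ext_mSum`).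

Injective dimension and resolution both come from one natural exact sequence 0 → m(M) → Col(M)^(n+1)
→ coind(M) → 0, the direct sum of the sequences 0 → m_k(M) → Col(M) → Col(M)/m_k(M) → 0 for k = 0,
…, n, with m_0 = 0. Coinduction does not raise injective dimension, and Col(M) is a summand of
coind(M), so passing to the kernel costs one degree (`hasInjectiveDimensionLE_mSum`). For M = D(A)
the cokernel is D(B), and a mapping cone turns an add(T)-resolution of D(A) into an
add(m(T))-resolution of D(B) (`HasAddResolution.cone`, `hasAddResolution_mSum`).

Endomorphisms: a map m_i(T) → m_j(T) is an endomorphism of T if i ≤ j and zero otherwise. These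
matrices are lower triangular; reversing the order of the indices makes them upper triangular. -/

/-! ### Vanishing of Ext and injective dimension along an adjunction. -/

section ExtAdjunction

open Limits Abelian

universe w₁ w₂ v₁ v₂ u₁ u₂

variable {C : Type u₁} {D : Type u₂} [Category.{v₁} C] [Category.{v₂} D] [Abelian C] [Abelian D]
  [HasExt.{w₁} C] [HasExt.{w₂} D] {F : C ⥤ D} {G : D ⥤ C}

/-- If the right adjoint `G` is exact and the left adjoint `F` preserves monomorphisms, then the
vanishing of `Ext X (G Y)` implies the vanishing of `Ext (F X) Y`. -/
theorem CategoryTheory.Adjunction.subsingleton_ext_leftAdjoint_obj (adj : F ⊣ G) [G.Additive]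
    [PreservesFiniteLimits G] [PreservesFiniteColimits G] [F.PreservesMonomorphisms]
    [EnoughInjectives D] (X : C) (Y : D) (i : ℕ) (h : Subsingleton (Ext X (G.obj Y) (i + 1))) :
    Subsingleton (Ext (F.obj X) Y (i + 1)) := by
  induction i generalizing Y with
  | zero =>
    let I : InjectivePresentation Y := Classical.arbitrary _
    let S := ShortComplex.mk _ _ (cokernel.condition I.f)
    have hS : S.ShortExact := { exact := ShortComplex.exact_cokernel I.f }
    refine subsingleton_of_forall_eq 0 fun e => ?_
    obtain ⟨x, rfl⟩ := Ext.covariant_sequence_exact₁ _ hS e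
      (Ext.eq_zero_of_injective _) (zero_add 1)
    obtain ⟨f, rfl⟩ := Ext.mk₀_bijective _ _ |>.2 x
    -- The adjoint of f : F X → I/Y lifts to G I, since the obstruction lies in Ext¹(X, G Y) = 0.
    -- Transposing back, f factors through I, so its connecting class vanishes.
    obtain ⟨y, hy⟩ := Ext.covariant_sequence_exact₃ X (hS.map G)
      (Ext.mk₀ (adj.homEquiv X _ f)) (zero_add 1) (h.elim _ _)
    obtain ⟨g, rfl⟩ := Ext.mk₀_bijective _ _ |>.2 y
    rw [Ext.mk₀_comp_mk₀] at hy
    have hg : (show X ⟶ G.obj S.X₂ from g) ≫ G.map S.g = adj.homEquiv X _ f :=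
      (Ext.mk₀_bijective _ _).1 hy
    have hf : f = (adj.homEquiv X _).symm (show X ⟶ G.obj S.X₂ from g) ≫ S.g := by
      apply (adj.homEquiv X _).injective
      rw [adj.homEquiv_naturality_right, Equiv.apply_symm_apply]
      exact hg.symm
    rw [hf, ← Ext.mk₀_comp_mk₀, Ext.comp_assoc_of_second_deg_zero, hS.comp_extClass,
      Ext.comp_zero]
  | succ i ih =>
    let I : InjectivePresentation Y := Classical.arbitrary _
    let S := ShortComplex.mk _ _ (cokernel.condition I.f)
    have hS : S.ShortExact := { exact := ShortComplex.exact_cokernel I.f }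
    -- G I is injective because F preserves monomorphisms, so dimension shifting works on both sides
    -- of the adjunction.
    have : Injective (S.map G).X₂ := adj.map_injective _ I.injective
    have : Subsingleton (Ext X (G.obj S.X₃) (i + 1)) := by
      refine subsingleton_of_forall_eq 0 fun e => ?_
      obtain ⟨x, rfl⟩ := Ext.covariant_sequence_exact₃ X (hS.map G) e rfl (h.elim _ _)
      rw [Ext.eq_zero_of_injective x]
      exact Ext.zero_comp (β := Ext.mk₀ (S.map G).g) ..
    have := ih S.X₃ this
    refine subsingleton_of_forall_eq 0 fun e => ?_
    obtain ⟨x, rfl⟩ := Ext.covariant_sequence_exact₁ _ hS e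
      (Ext.eq_zero_of_injective _) rfl
    rw [Subsingleton.elim x 0, Ext.zero_comp]

/-- If the left adjoint `F` is exact and the right adjoint `G` preserves epimorphisms, then the
vanishing of `Ext (F X) Y` implies the vanishing of `Ext X (G Y)`. -/
theorem CategoryTheory.Adjunction.subsingleton_ext_rightAdjoint_obj (adj : F ⊣ G) [F.Additive]
    [PreservesFiniteLimits F] [PreservesFiniteColimits F] [G.PreservesEpimorphisms]
    [EnoughProjectives C] (X : C) (Y : D) (i : ℕ) (h : Subsingleton (Ext (F.obj X) Y (i + 1))) :
    Subsingleton (Ext X (G.obj Y) (i + 1)) := by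
  induction i generalizing X with
  | zero =>
    let P : ProjectivePresentation X := Classical.arbitrary _
    let S := ShortComplex.mk _ _ (kernel.condition P.f)
    have hS : S.ShortExact := { exact := ShortComplex.exact_kernel P.f }
    refine subsingleton_of_forall_eq 0 fun e => ?_
    obtain ⟨x, rfl⟩ := Ext.contravariant_sequence_exact₃ hS _ e
      (Ext.eq_zero_of_projective _) (add_zero 1)
    obtain ⟨f, rfl⟩ := Ext.mk₀_bijective _ _ |>.2 x
    obtain ⟨y, hy⟩ := Ext.contravariant_sequence_exact₁ (hS.map F) Y
      (Ext.mk₀ ((adj.homEquiv _ Y).symm f)) (add_zero 1) (h.elim _ _)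
    obtain ⟨g, rfl⟩ := Ext.mk₀_bijective _ _ |>.2 y
    rw [Ext.mk₀_comp_mk₀] at hy
    have hg : F.map S.f ≫ (show F.obj S.X₂ ⟶ Y from g) = (adj.homEquiv _ Y).symm f :=
      (Ext.mk₀_bijective _ _).1 hy
    have hf : f = S.f ≫ adj.homEquiv _ Y (show F.obj S.X₂ ⟶ Y from g) := by
      apply (adj.homEquiv _ Y).symm.injective
      rw [adj.homEquiv_naturality_left_symm, Equiv.symm_apply_apply]
      exact hg.symm
    rw [hf, ← Ext.mk₀_comp_mk₀, ← Ext.comp_assoc_of_second_deg_zero, hS.extClass_comp,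
      Ext.zero_comp]
  | succ i ih =>
    let P : ProjectivePresentation X := Classical.arbitrary _
    let S := ShortComplex.mk _ _ (kernel.condition P.f)
    have hS : S.ShortExact := { exact := ShortComplex.exact_kernel P.f }
    have : Projective (S.map F).X₂ := adj.map_projective _ P.projective
    have : Subsingleton (Ext (F.obj S.X₁) Y (i + 1)) := by
      refine subsingleton_of_forall_eq 0 fun e => ?_
      obtain ⟨x, rfl⟩ := Ext.contravariant_sequence_exact₁ (hS.map F) Y e (add_comm 1 _)
        (h.elim _ _)
      rw [Ext.eq_zero_of_projective x]
      exact Ext.comp_zero _ _ _ _ _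
    have := ih S.X₁ this
    refine subsingleton_of_forall_eq 0 fun e => ?_
    obtain ⟨x, rfl⟩ := Ext.contravariant_sequence_exact₃ hS _ e
      (Ext.eq_zero_of_projective _) (add_comm 1 _)
    rw [Subsingleton.elim x 0, Ext.comp_zero]

/-- The injective dimension does not increase under a right adjoint that preserves epimorphisms
and has an exact left adjoint. -/
theorem CategoryTheory.Adjunction.hasInjectiveDimensionLE_rightAdjoint_obj (adj : F ⊣ G)
    [F.Additive] [PreservesFiniteLimits F] [PreservesFiniteColimits F] [G.PreservesEpimorphisms]
    [EnoughProjectives C] (Y : D) (r : ℕ) (h : HasInjectiveDimensionLE Y r) :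
    HasInjectiveDimensionLE (G.obj Y) r := by
  refine HasInjectiveDimensionLT.mk fun i hi X e => ?_
  obtain ⟨i, rfl⟩ := Nat.exists_eq_succ_of_ne_zero (by omega : i ≠ 0)
  have := adj.subsingleton_ext_rightAdjoint_obj X Y i
    (HasInjectiveDimensionLT.subsingleton Y (r + 1) (i + 1) hi _)
  exact Subsingleton.elim _ _

/-- If the identity of `Y` is a finite sum of endomorphisms factoring through objects `Z j` with
`Ext X (Z j) = 0`, then `Ext X Y = 0`. -/
theorem CategoryTheory.Abelian.Ext.subsingleton_of_id_eq_sum {ι : Type*} [Fintype ι] {X Y : C}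
    (Z : ι → C) (p : ∀ j, Y ⟶ Z j) (s : ∀ j, Z j ⟶ Y) (hid : 𝟙 Y = ∑ j, p j ≫ s j) (i : ℕ)
    (h : ∀ j, Subsingleton (Ext X (Z j) i)) : Subsingleton (Ext X Y i) := by
  refine subsingleton_of_forall_eq 0 fun e => ?_
  rw [← e.comp_mk₀_id, hid, Ext.mk₀_sum, Ext.comp_sum]
  refine Finset.sum_eq_zero fun j _ => ?_
  rw [← Ext.mk₀_comp_mk₀, ← Ext.comp_assoc_of_second_deg_zero,
    (h j).elim (e.comp (Ext.mk₀ (p j)) (add_zero i)) 0, Ext.zero_comp]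

end ExtAdjunction

/-! ### Scalar matrices and matrix units. -/

namespace UpperTriangular

variable (R : Type u) (n : ℕ) {A : Type u} [CommRing R] [Ring A] [Algebra R A]

/-- The embedding of `A` into `T_n(A)` as scalar matrices. -/
def diag : A →+* UpperTriangular R n A :=
  (Matrix.scalar (Fin n)).codRestrict (UpperTriangular R n A) fun a i j hij => by
    simp [Matrix.diagonal_apply_ne _ hij.ne']

variable {n} in
/-- The matrix unit with entry `1` in position `(i, j)` if `i ≤ j`, and zero otherwise. -/
def unit (i j : Fin n) : UpperTriangular R n A :=
  ⟨Matrix.of fun k l => if i ≤ j ∧ k = i ∧ l = j then 1 else 0, fun k l hkl =>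
    if_neg fun ⟨h, hk, hl⟩ => absurd h (by rw [← hk, ← hl]; exact not_le.2 hkl)⟩

variable {R n}

theorem diag_apply (a : A) (i j : Fin n) : (diag R n a).1 i j = if i = j then a else 0 := by
  change Matrix.diagonal (fun _ => a) i j = _
  rw [Matrix.diagonal_apply]

theorem unit_apply (i j k l : Fin n) :
    (unit R i j : UpperTriangular R n A).1 k l = if i ≤ j ∧ k = i ∧ l = j then 1 else 0 := rfl

theorem mul_apply (b c : UpperTriangular R n A) (i j : Fin n) :
    (b * c).1 i j = ∑ k, b.1 i k * c.1 k j := Matrix.mul_apply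

theorem sum_apply {ι : Type*} (s : Finset ι) (f : ι → UpperTriangular R n A) (i j : Fin n) :
    (∑ k ∈ s, f k).1 i j = ∑ k ∈ s, (f k).1 i j := by
  rw [← Subalgebra.coe_val, map_sum, Matrix.sum_apply]

@[ext]
theorem ext {b c : UpperTriangular R n A} (h : ∀ i j, b.1 i j = c.1 i j) : b = c :=
  Subtype.ext (Matrix.ext h)

theorem diag_mul_apply (a : A) (b : UpperTriangular R n A) (i j : Fin n) :
    (diag R n a * b).1 i j = a * b.1 i j := by
  simp [mul_apply, diag_apply]

theorem mul_diag_apply (a : A) (b : UpperTriangular R n A) (i j : Fin n) :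
    (b * diag R n a).1 i j = b.1 i j * a := by
  simp [mul_apply, diag_apply]

theorem mul_unit_apply (b : UpperTriangular R n A) {i j : Fin n} (h : i ≤ j) (k l : Fin n) :
    (b * unit R i j).1 k l = if l = j then b.1 k i else 0 := by
  simp [mul_apply, unit_apply, h, ite_and]

theorem unit_mul_apply (b : UpperTriangular R n A) {i j : Fin n} (h : i ≤ j) (k l : Fin n) :
    (unit R i j * b).1 k l = if k = i then b.1 j l else 0 := by
  simp [mul_apply, unit_apply, h, ite_and]

theorem unit_mul_diag (a : A) (i j : Fin n) :
    unit R i j * diag R n a = diag R n a * unit R i j := by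
  ext k l
  rw [diag_mul_apply, mul_diag_apply, unit_apply]
  split_ifs <;> simp

/-- Right multiplication by a matrix unit moves column i to column j. With the coefficients pulled
out as scalar matrices, this is the identity that makes `MSum.lift` linear. -/
theorem mul_unit (b : UpperTriangular R n A) {i j : Fin n} (h : i ≤ j) :
    b * unit R i j = ∑ k, diag R n (b.1 k i) * unit R k j := by
  ext k l
  rw [mul_unit_apply b h, sum_apply]
  simp only [diag_mul_apply, unit_apply]
  by_cases hl : l = j
  · subst hl
    by_cases hk : k ≤ l
    · rw [Finset.sum_eq_single k] <;> simp +contextual [hk, eq_comm]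
    -- For k > j the unit on the right is zero by convention, and the entry on the left is zero
    -- because i ≤ j < k.
    · rw [if_pos rfl, b.2 k i (lt_of_le_of_lt h (not_le.1 hk)), Finset.sum_eq_zero]
      intro m _
      rw [if_neg, mul_zero]
      rintro ⟨h1, rfl, -⟩
      exact hk h1
  · simp [hl]

theorem sum_unit : ∑ i, (unit R i i : UpperTriangular R n A) = 1 := by
  ext k l
  rw [sum_apply]
  simp only [unit_apply, le_rfl, true_and]
  change _ = (1 : Matrix (Fin n) (Fin n) A) k l
  rw [Matrix.one_apply]
  rcases eq_or_ne k l with rfl | h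
  · simp
  · rw [if_neg h, Finset.sum_eq_zero]
    rintro i -
    rw [if_neg]
    rintro ⟨rfl, rfl⟩
    exact h rfl

section Instances

variable {R : Type u} {n : ℕ} {A : Type u} [CommRing R] [Ring A] [Algebra R A]
  {M : Type u} [AddCommGroup M] [Module A M]

scoped instance (priority := high) {ι : Type} : AddCommGroup (ι → Column n M) :=
  Pi.addCommGroup

scoped instance (priority := high) {ι : Type} :
    Module (UpperTriangular R n A) (ι → Column n M) :=
  Pi.module _ _ _

scoped instance (priority := high) : AddCommGroup (MSum R n A M) := Pi.addCommGroup

scoped instance (priority := high) : Module (UpperTriangular R n A) (MSum R n A M) :=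
  Pi.module _ _ _

end Instances

end UpperTriangular

/-! ### Columns and m(M): entries, generators and maps out of m(M). -/

section TriangularModules

open UpperTriangular

namespace Column

variable {R : Type u} {n : ℕ} {A : Type u} [CommRing R] [Ring A] [Algebra R A]
  {M N : Type u} [AddCommGroup M] [Module A M] [AddCommGroup N] [Module A N]

theorem smul_apply (b : UpperTriangular R n A) (x : Column n M) (i : Fin n) :
    (b • x) i = ∑ j, b.1 i j • x j := rfl

theorem diag_smul_apply (a : A) (x : Column n M) (i : Fin n) :
    (diag R n a • x) i = a • x i := by
  simp [smul_apply, diag_apply]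

theorem unit_smul_apply {i j : Fin n} (h : i ≤ j) (x : Column n M) (k : Fin n) :
    ((unit R i j : UpperTriangular R n A) • x) k = if k = i then x j else 0 := by
  rw [smul_apply, Finset.sum_eq_single j]
  · simp [unit_apply, h, ite_smul]
  · intro l _ hl
    simp [unit_apply, hl]
  · simp

variable (R n) in
/-- The entrywise application of an `A`-linear map to columns. -/
def map (f : M →ₗ[A] N) : Column n M →ₗ[UpperTriangular R n A] Column n N where
  toFun x := fun i => f (x i)
  map_add' x y := funext fun i => map_add f _ _
  map_smul' b x := funext fun i => by
    change f (∑ j, b.1 i j • x j) = ∑ j, b.1 i j • f (x j)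
    rw [map_sum]
    simp only [map_smul]

end Column

namespace MSum

variable {R : Type u} {n : ℕ} {A : Type u} [CommRing R] [Ring A] [Algebra R A]
  {M N : Type u} [AddCommGroup M] [Module A M] [AddCommGroup N] [Module A N]

/-- The entry in row `j` of the component of `x` in `m_i(M)`. -/
def entry (x : MSum R n A M) (i j : Fin n) : M := (x i).1 j

@[ext]
theorem ext {x y : MSum R n A M} (h : ∀ i j, entry x i j = entry y i j) : x = y :=
  funext fun i => Subtype.ext (funext (h i))

/-- The element of `m(M)` with prescribed entries. -/
def mk (f : Fin n → Fin n → M) (hf : ∀ i j, i < j → f i j = 0) : MSum R n A M :=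
  fun i => ⟨f i, hf i⟩

@[simp]
theorem entry_mk (f : Fin n → Fin n → M) (hf : ∀ i j, i < j → f i j = 0) (i j : Fin n) :
    entry (mk f hf : MSum R n A M) i j = f i j := rfl

theorem entry_of_lt (x : MSum R n A M) {i j : Fin n} (h : i < j) : entry x i j = 0 :=
  (x i).2 j h

@[simp]
theorem entry_add (x y : MSum R n A M) (i j : Fin n) :
    entry (x + y) i j = entry x i j + entry y i j := rfl

@[simp]
theorem entry_zero (i j : Fin n) : entry (0 : MSum R n A M) i j = 0 := rfl

theorem entry_smul (b : UpperTriangular R n A) (x : MSum R n A M) (i j : Fin n) :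
    entry (b • x) i j = ∑ k, b.1 j k • entry x i k := rfl

variable (R A M) in
/-- `MSum.entry` as a homomorphism of groups. -/
def entryHom (i j : Fin n) : MSum R n A M →+ M where
  toFun x := entry x i j
  map_zero' := rfl
  map_add' _ _ := rfl

@[simp]
theorem entry_sum {ι : Type*} (s : Finset ι) (f : ι → MSum R n A M) (i j : Fin n) :
    entry (∑ k ∈ s, f k) i j = ∑ k ∈ s, entry (f k) i j :=
  map_sum (entryHom R A M i j) f s

@[simp]
theorem entry_diag_smul (a : A) (x : MSum R n A M) (i j : Fin n) :
    entry (diag R n a • x) i j = a • entry x i j := Column.diag_smul_apply a (x i).1 j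

theorem entry_unit_smul (i j : Fin n) (x : MSum R n A M) (k l : Fin n) :
    entry ((unit R i j : UpperTriangular R n A) • x) k l =
      if i ≤ j ∧ l = i then entry x k j else 0 := by
  by_cases h : i ≤ j
  · rw [if_congr (and_iff_right h) rfl rfl]
    exact Column.unit_smul_apply h (x k).1 l
  · simp [entry_smul, unit_apply, h]

variable (R n) in
/-- The functorial action of `M ↦ m(M)` on `A`-linear maps. -/
def map (f : M →ₗ[A] N) : MSum R n A M →ₗ[UpperTriangular R n A] MSum R n A N where
  toFun x := mk (fun i j => f (entry x i j)) fun i j hj => by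
    rw [entry_of_lt x hj, map_zero]
  map_add' x y := ext fun i j => map_add f _ _
  map_smul' b x := ext fun i j => by
    change f (∑ k, b.1 j k • entry x i k) = ∑ k, b.1 j k • f (entry x i k)
    rw [map_sum]
    simp only [map_smul]

@[simp]
theorem entry_map (f : M →ₗ[A] N) (x : MSum R n A M) (i j : Fin n) :
    entry (map R n f x) i j = f (entry x i j) := rfl

variable (R A) in
/-- The element of `m(M)` with the single entry `p`, in row `i` of the summand `m_i(M)`. -/
def gen (i : Fin n) (p : M) : MSum R n A M :=
  mk (fun k l => if k = i ∧ l = i then p else 0) fun k l hl => if_neg (by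
    rintro ⟨rfl, rfl⟩; exact lt_irrefl _ hl)

theorem entry_gen (i : Fin n) (p : M) (k l : Fin n) :
    entry (gen R A i p) k l = if k = i ∧ l = i then p else 0 := rfl

/-- The last nonzero row i generates m_i(M), as the unit at (j, i) carries it to row j. This gives
uniqueness of maps out of m(M), and also splits m(M) over A into copies of M. -/
theorem eq_sum_unit_smul_gen (x : MSum R n A M) :
    x = ∑ i, ∑ j, (unit R j i : UpperTriangular R n A) • gen R A i (entry x i j) := by
  ext k l
  simp only [entry_sum, entry_unit_smul, entry_gen]
  rw [Finset.sum_eq_single k, Finset.sum_eq_single l]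
  · by_cases h : l ≤ k
    · simp [h]
    · simp [h, entry_of_lt x (not_le.1 h)]
  · intro j _ hj
    simp [hj.symm]
  · simp
  · intro i _ hi
    simp [hi.symm]
  · simp

theorem hom_ext {X : Type*} [AddCommGroup X] [Module (UpperTriangular R n A) X]
    {f g : MSum R n A M →ₗ[UpperTriangular R n A] X}
    (h : ∀ i p, f (gen R A i p) = g (gen R A i p)) : f = g := by
  refine LinearMap.ext fun x => ?_
  rw [eq_sum_unit_smul_gen x]
  simp only [map_sum, map_smul, h]

/-- The `T_n(A)`-linear map `m(M) → X` that extends an additive map `M → X` which is linear with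
respect to scalar matrices. -/
def lift {X : Type*} [AddCommGroup X] [Module (UpperTriangular R n A) X] (f : M →+ X)
    (hf : ∀ (a : A) (p : M), f (a • p) = diag R n a • f p) :
    MSum R n A M →ₗ[UpperTriangular R n A] X where
  toFun x := ∑ i, ∑ j, (unit R j i : UpperTriangular R n A) • f (entry x i j)
  map_add' x y := by
    simp only [entry_add, map_add, smul_add, Finset.sum_add_distrib]
  map_smul' b x := by
    simp only [entry_smul, map_sum, hf, Finset.smul_sum, RingHom.id_apply]
    refine Finset.sum_congr rfl fun i _ => ?_
    rw [Finset.sum_comm]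
    refine Finset.sum_congr rfl fun j _ => ?_
    -- `mul_unit` needs j ≤ i; for j > i the entry of m_i(M) in row j is zero.
    by_cases h : j ≤ i
    · rw [smul_smul b, mul_unit b h, Finset.sum_smul]
      refine Finset.sum_congr rfl fun l _ => ?_
      rw [smul_smul, unit_mul_diag]
    · simp [entry_of_lt x (not_le.1 h)]

theorem lift_gen {X : Type*} [AddCommGroup X] [Module (UpperTriangular R n A) X] (f : M →+ X)
    (hf : ∀ (a : A) (p : M), f (a • p) = diag R n a • f p) (i : Fin n) (p : M) :
    lift f hf (gen R A i p) = (unit R i i : UpperTriangular R n A) • f p := by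
  change ∑ k, ∑ l, (unit R l k : UpperTriangular R n A) • f (entry (gen R A i p) k l) = _
  rw [Finset.sum_eq_single i, Finset.sum_eq_single i]
  · simp [entry_gen]
  · intro j _ hj; simp [entry_gen, hj]
  · simp
  · intro j _ hj; simp [entry_gen, hj]
  · simp

variable (R n A) in
/-- The embedding `M → m(M)`, placing an element in row `i` of `m_i(M)` for all `i`. -/
def incl : M →+ MSum R n A M where
  toFun p := mk (fun i j => if i = j then p else 0) fun i j h => if_neg h.ne
  map_zero' := by ext; simp
  map_add' p q := by
    ext i j
    simp only [entry_mk, entry_add]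
    split_ifs <;> simp

@[simp]
theorem entry_incl (p : M) (i j : Fin n) :
    entry (incl R n A p) i j = if i = j then p else 0 := rfl

theorem incl_smul (a : A) (p : M) : incl R n A (a • p) = diag R n a • incl R n A p := by
  ext i j
  simp

theorem unit_smul_incl (i : Fin n) (p : M) :
    (unit R i i : UpperTriangular R n A) • incl R n A p = gen R A i p := by
  ext k l
  simp only [entry_unit_smul, entry_incl, entry_gen, le_rfl, true_and]
  split_ifs <;> tauto

theorem gen_add (i : Fin n) (p q : M) : gen R A i (p + q) = gen R A i p + gen R A i q := by
  simp only [← unit_smul_incl, map_add, smul_add]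

theorem gen_smul (i : Fin n) (a : A) (p : M) :
    gen R A i (a • p) = diag R n a • gen R A i p := by
  rw [← unit_smul_incl, ← unit_smul_incl, incl_smul, smul_smul, smul_smul, unit_mul_diag]

theorem incl_eq_sum (p : M) : incl R n A p = ∑ i, gen R A i p := by
  ext k l
  simp only [entry_incl, entry_sum, entry_gen]
  rw [Finset.sum_eq_single k]
  · simp [eq_comm]
  · intro j _ hj; simp [hj.symm]
  · simp

theorem lift_incl {X : Type*} [AddCommGroup X] [Module (UpperTriangular R n A) X] (f : M →+ X)
    (hf : ∀ (a : A) (p : M), f (a • p) = diag R n a • f p) (p : M) :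
    lift f hf (incl R n A p) = f p := by
  rw [incl_eq_sum, map_sum]
  simp only [lift_gen]
  rw [← Finset.sum_smul, sum_unit, one_smul]

theorem lift_eq {X : Type*} [AddCommGroup X] [Module (UpperTriangular R n A) X]
    (f : M →+ X) (hf : ∀ (a : A) (p : M), f (a • p) = diag R n a • f p)
    (g : MSum R n A M →ₗ[UpperTriangular R n A] X)
    (hg : ∀ p, g (incl R n A p) = f p) : lift f hf = g := by
  refine hom_ext fun i p => ?_
  rw [← unit_smul_incl, map_smul, map_smul, lift_incl, hg]

end MSum

theorem MSum.map_incl {R : Type u} {n : ℕ} {A : Type u} [CommRing R] [Ring A] [Algebra R A]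
    {M N : Type u} [AddCommGroup M] [Module A M] [AddCommGroup N] [Module A N]
    (f : M →ₗ[A] N) (p : M) : MSum.map R n f (MSum.incl R n A p) = MSum.incl R n A (f p) :=
  MSum.ext fun i j => by
    rw [MSum.entry_map, MSum.entry_incl, MSum.entry_incl, apply_ite f, map_zero]

/-! ### The adjunction between m and restriction to scalar matrices. -/

section Functors

variable (R : Type u) (n : ℕ) (A : Type u) [CommRing R] [Ring A] [Algebra R A]

/-- The functor `M ↦ m(M)`. -/
def mFunctor : ModuleCat.{u} A ⥤ ModuleCat.{u} (UpperTriangular R n A) where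
  obj M := ModuleCat.of _ (MSum R n A M)
  map f := ModuleCat.ofHom (MSum.map R n f.hom)
  map_id _ := rfl
  map_comp _ _ := rfl

/-- The restriction of modules along the embedding of `A` into `T_n(A)` as scalar matrices. -/
noncomputable abbrev resDiag : ModuleCat.{u} (UpperTriangular R n A) ⥤ ModuleCat.{u} A :=
  ModuleCat.restrictScalars.{u} (diag R n (A := A))

variable {A} in
/-- The bijection between maps `m(M) → X` over `T_n(A)` and maps `M → X` over `A`. -/
noncomputable def mHomEquiv (M : ModuleCat.{u} A) (X : ModuleCat.{u} (UpperTriangular R n A)) :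
    ((mFunctor R n A).obj M ⟶ X) ≃ (M ⟶ (resDiag R n A).obj X) where
  toFun g := ModuleCat.ofHom (Y := (resDiag R n A).obj X)
    { toFun := fun p => g.hom (MSum.incl R n A p)
      map_add' := fun p q =>
        (congrArg g.hom (map_add (MSum.incl R n A) p q)).trans (g.hom.map_add _ _)
      map_smul' := fun a p =>
        (congrArg g.hom (MSum.incl_smul a p)).trans (g.hom.map_smul (diag R n a) _) }
  invFun f := ModuleCat.ofHom (X := MSum R n A M) (Y := X)
    (MSum.lift (X := X) (f.hom.toAddMonoidHom : M →+ X) fun a p => f.hom.map_smul a p)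
  left_inv g := ModuleCat.hom_ext (MSum.lift_eq (X := X) _
    (fun a p => (congrArg g.hom (MSum.incl_smul a p)).trans (g.hom.map_smul (diag R n a) _))
    g.hom fun _ => rfl)
  right_inv f := ModuleCat.hom_ext (LinearMap.ext fun p =>
    MSum.lift_incl (X := X) _ (fun a p => f.hom.map_smul a p) p)

/-- The functor `M ↦ m(M)` is left adjoint to the restriction along the embedding of `A` into
`T_n(A)` as scalar matrices. -/
noncomputable def mAdjunction : mFunctor R n A ⊣ resDiag R n A :=
  Adjunction.mkOfHomEquiv
    { homEquiv := mHomEquiv R n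
      homEquiv_naturality_left_symm := by
        intro M N X f g
        apply (mHomEquiv R n M X).injective
        rw [Equiv.apply_symm_apply]
        obtain ⟨h, rfl⟩ := (mHomEquiv R n N X).surjective g
        rw [Equiv.symm_apply_apply]
        refine ModuleCat.hom_ext (LinearMap.ext fun p => ?_)
        exact congrArg h.hom (MSum.map_incl f.hom p).symm
      homEquiv_naturality_right := fun _ _ => rfl }

instance : (mFunctor R n A).PreservesMonomorphisms where
  preserves f hf := by
    rw [ModuleCat.mono_iff_injective] at hf ⊢
    intro x y hxy
    refine MSum.ext fun i j => hf ?_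
    exact congrArg (fun z => MSum.entry z i j) hxy

/-- Restriction is exact because it has adjoints on both sides: m on the left and, in the next
instance, coinduction on the right. -/
instance : Limits.PreservesFiniteLimits (resDiag R n A) :=
  have : Limits.PreservesLimitsOfSize.{0, 0} (resDiag R n A) :=
    (mAdjunction R n A).rightAdjoint_preservesLimits
  inferInstance

instance : Limits.PreservesFiniteColimits (resDiag R n A) :=
  have : Limits.PreservesColimitsOfSize.{0, 0} (resDiag R n A) :=
    (ModuleCat.restrictCoextendScalarsAdj.{u, u, u}
      (diag R n (A := A))).leftAdjoint_preservesColimits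
  inferInstance

/-- The coinduction of modules along the embedding of `A` into `T_n(A)` as scalar matrices. -/
noncomputable abbrev coextDiag : ModuleCat.{u} A ⥤ ModuleCat.{u} (UpperTriangular R n A) :=
  ModuleCat.coextendScalars.{u, u, u} (diag R n (A := A))

end Functors

/-! ### Elements of the coinduced module. -/

section Coextension

variable {R : Type u} {n : ℕ} {A : Type u} [CommRing R] [Ring A] [Algebra R A]

/-- The element of the coinduced module given by a function that is linear with respect to scalar
matrices. -/
noncomputable def coextMk (M : ModuleCat.{u} A) (f : UpperTriangular R n A →+ M)
    (hf : ∀ a b, f (diag R n a * b) = a • f b) : (coextDiag R n A).obj M :=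
  (ModuleCat.CoextendScalars.equiv _ M).symm
    { toFun := f
      map_add' := f.map_add
      map_smul' := hf }

theorem coext_ext {M : ModuleCat.{u} A} {φ ψ : (coextDiag R n A).obj M}
    (h : ∀ b : UpperTriangular R n A, φ b = ψ b) : φ = ψ :=
  ModuleCat.CoextendScalars.ext (LinearMap.ext h)

theorem coext_diag_mul {M : ModuleCat.{u} A} (φ : (coextDiag R n A).obj M) (a : A)
    (b : UpperTriangular R n A) : φ (diag R n a * b) = a • φ b :=
  (ModuleCat.CoextendScalars.equiv _ M φ).map_smul a b

theorem coext_add {M : ModuleCat.{u} A} (φ : (coextDiag R n A).obj M)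
    (b c : UpperTriangular R n A) : φ (b + c) = φ b + φ c :=
  (ModuleCat.CoextendScalars.equiv _ M φ).map_add b c

theorem coext_sum {M : ModuleCat.{u} A} (φ : (coextDiag R n A).obj M) {ι : Type*} (s : Finset ι)
    (f : ι → UpperTriangular R n A) : φ (∑ i ∈ s, f i : UpperTriangular R n A) = ∑ i ∈ s, φ (f i) :=
  map_sum (ModuleCat.CoextendScalars.equiv _ M φ) f s

end Coextension

/-! ### The exact sequence 0 → m(M) → Col(M)^(n+1) → coind(M) → 0. -/

section CoinductionSequence

variable {R : Type u} {n : ℕ} {A : Type u} [CommRing R] [Ring A] [Algebra R A]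

/-- The matrix units span the algebra over A, so an element of the coinduced module is determined by
its values on them. -/
theorem UpperTriangular.eq_sum_diag_mul_unit (b : UpperTriangular R n A) :
    b = ∑ i, ∑ j, diag R n (b.1 i j) * unit R i j := by
  ext k l
  simp only [UpperTriangular.sum_apply, diag_mul_apply, unit_apply]
  rw [Finset.sum_eq_single k, Finset.sum_eq_single l]
  · by_cases h : k ≤ l
    · simp [h]
    · simp [h, b.2 k l (not_le.1 h)]
  · intro j _ hj; simp [hj.symm]
  · simp
  · intro j _ hj; simp [hj.symm]
  · simp

theorem coext_apply_eq_sum {M : ModuleCat.{u} A} (φ : (coextDiag R n A).obj M)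
    (b : UpperTriangular R n A) :
    φ b = ∑ i, ∑ j, b.1 i j • φ (unit R i j : UpperTriangular R n A) := by
  conv_lhs => rw [eq_sum_diag_mul_unit b, coext_sum]
  refine Finset.sum_congr rfl fun i _ => ?_
  rw [coext_sum]
  exact Finset.sum_congr rfl fun j _ => coext_diag_mul φ _ _

variable (R n) in
/-- The embedding of `m(M)` into a direct sum of copies of the module of all columns. -/
def MSum.toColumns (M : Type u) [AddCommGroup M] [Module A M] :
    MSum R n A M →ₗ[UpperTriangular R n A] (Fin (n + 1) → Column n M) where
  -- Slot k holds m_k(M) in the numbering from 1, and slot 0 holds m_0 = 0.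
  toFun x := Fin.cons 0 fun i => (x i).1
  map_add' x y := by
    funext k
    refine Fin.cases ?_ (fun i => ?_) k
    · exact (add_zero (0 : Column n M)).symm
    · rfl
  map_smul' b x := by
    funext k
    refine Fin.cases ?_ (fun i => ?_) k
    · exact (smul_zero b).symm
    · rfl

variable (R) in
/-- The map from a direct sum of copies of the module of all columns to the coinduced module. -/
noncomputable def columnsToCoext (M : ModuleCat.{u} A) :
    (Fin (n + 1) → Column n M) →ₗ[UpperTriangular R n A] (coextDiag R n A).obj M where
  toFun c := coextMk M
    -- On the unit at (k, j) this reads off row j of slot k, for k ≤ j, so slot k contributes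
    -- Col/m_k. The last slot is dropped because Col/m_n = 0.
    { toFun := fun b => ∑ k : Fin n, (b • c k.castSucc) k
      map_zero' := by
        refine Finset.sum_eq_zero fun k _ => ?_
        rw [zero_smul]; rfl
      map_add' := fun b b' => by
        rw [← Finset.sum_add_distrib]
        refine Finset.sum_congr rfl fun k _ => ?_
        rw [add_smul]; rfl }
    fun a b => by
      change ∑ k : Fin n, ((diag R n a * b) • c k.castSucc) k =
        a • ∑ k : Fin n, (b • c k.castSucc) k
      rw [Finset.smul_sum]
      refine Finset.sum_congr rfl fun k _ => ?_
      rw [mul_smul, Column.diag_smul_apply]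
  map_add' c c' := coext_ext fun b => by
    change ∑ k : Fin n, (b • (c k.castSucc + c' k.castSucc)) k =
      ∑ k : Fin n, (b • c k.castSucc) k + ∑ k : Fin n, (b • c' k.castSucc) k
    rw [← Finset.sum_add_distrib]
    refine Finset.sum_congr rfl fun k _ => ?_
    rw [smul_add]; rfl
  map_smul' b' c := coext_ext fun b => by
    change ∑ k : Fin n, (b • b' • c k.castSucc) k = ∑ k : Fin n, ((b * b') • c k.castSucc) k
    simp only [mul_smul]

theorem columnsToCoext_apply (M : ModuleCat.{u} A) (c : Fin (n + 1) → Column n M)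
    (b : UpperTriangular R n A) :
    columnsToCoext R M c b = ∑ k : Fin n, (b • c k.castSucc) k := rfl

theorem columnsToCoext_unit (M : ModuleCat.{u} A) (c : Fin (n + 1) → Column n M) {i j : Fin n}
    (h : i ≤ j) :
    columnsToCoext R M c (unit R i j : UpperTriangular R n A) = c i.castSucc j := by
  rw [columnsToCoext_apply, Finset.sum_eq_single i]
  · rw [Column.unit_smul_apply h, if_pos rfl]
  · intro k _ hk
    rw [Column.unit_smul_apply h, if_neg hk]
  · simp

/-- Evaluation at the matrix units recovers the entries with i ≤ j; the others only meet the zero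
entries of b below the diagonal. -/
theorem columnsToCoext_eq_zero_iff (M : ModuleCat.{u} A) (c : Fin (n + 1) → Column n M) :
    columnsToCoext R M c = 0 ↔ ∀ i j : Fin n, i ≤ j → c i.castSucc j = 0 := by
  constructor
  · intro h i j hij
    rw [← columnsToCoext_unit (R := R) M c hij, h]
    rfl
  · intro h
    refine coext_ext fun b => ?_
    rw [columnsToCoext_apply]
    change _ = (0 : M)
    refine Finset.sum_eq_zero fun k _ => ?_
    rw [Column.smul_apply]
    refine Finset.sum_eq_zero fun j _ => ?_
    rcases le_or_gt k j with hkj | hkj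
    · rw [h k j hkj, smul_zero]
    · rw [b.2 k j hkj, zero_smul]

theorem columnsToCoext_surjective (M : ModuleCat.{u} A) :
    Function.Surjective (columnsToCoext R (n := n) M) := by
  intro φ
  -- The last slot does not affect the image; 0 is a filler.
  refine ⟨fun k j => if h : k.1 < n then φ (unit R ⟨k, h⟩ j : UpperTriangular R n A) else 0, ?_⟩
  refine coext_ext fun b => ?_
  rw [coext_apply_eq_sum, coext_apply_eq_sum φ]
  refine Finset.sum_congr rfl fun i _ => Finset.sum_congr rfl fun j _ => ?_
  rcases le_or_gt i j with hij | hij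
  · refine congrArg (b.1 i j • ·) ((columnsToCoext_unit M _ hij).trans ?_)
    exact dif_pos i.2
  · rw [b.2 i j hij, zero_smul, zero_smul]

theorem MSum.toColumns_injective (M : Type u) [AddCommGroup M] [Module A M] :
    Function.Injective (MSum.toColumns R n (A := A) M) := by
  intro x y h
  exact funext fun i => Subtype.ext (congrFun h i.succ)

/-- In the kernel, slot k vanishes from row k on (rows from 0), which is membership in `mBranch` at
index k - 1. Slot 0 is therefore zero, and slot n is unconstrained. -/
theorem exact_toColumns_columnsToCoext (M : ModuleCat.{u} A) :
    Function.Exact (MSum.toColumns R n (A := A) M) (columnsToCoext R (n := n) M) := by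
  intro c
  rw [columnsToCoext_eq_zero_iff]
  constructor
  · intro h
    refine ⟨fun i => ⟨c i.succ, fun j hj => ?_⟩, ?_⟩
    · have hi : i.1 + 1 < n := lt_of_le_of_lt (Nat.succ_le_of_lt hj) j.2
      exact h ⟨i.1 + 1, hi⟩ j (Nat.succ_le_of_lt hj)
    · funext k
      refine Fin.cases ?_ (fun i => rfl) k
      funext j
      exact (h ⟨0, lt_of_le_of_lt (Nat.zero_le _) j.2⟩ j (Nat.zero_le _)).symm
  · rintro ⟨x, rfl⟩ i j hij
    obtain ⟨i, hi⟩ := i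
    cases i with
    | zero => rfl
    | succ i =>
      exact MSum.entry_of_lt x (i := ⟨i, Nat.lt_of_succ_lt hi⟩) (Nat.lt_of_succ_le hij)

theorem columnsToCoext_naturality {M N : ModuleCat.{u} A} (f : M ⟶ N)
    (c : Fin (n + 1) → Column n M) :
    columnsToCoext R N (fun k => Column.map R n f.hom (c k)) =
      (coextDiag R n A).map f (columnsToCoext R M c) := by
  refine coext_ext fun b => ?_
  rw [ModuleCat.CoextendScalars.map_apply, columnsToCoext_apply, columnsToCoext_apply]
  rw [map_sum]
  refine Finset.sum_congr rfl fun k _ => ?_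
  rw [← map_smul]
  rfl

/-- An element of the coinduced module is represented by columns, whose entries can be lifted
independently. This is what keeps coinduction from raising injective dimension. -/
instance : (coextDiag R n A).PreservesEpimorphisms where
  preserves {M N} f hf := by
    rw [ModuleCat.epi_iff_surjective] at hf ⊢
    intro φ
    obtain ⟨c, rfl⟩ := columnsToCoext_surjective N φ
    choose g hg using hf
    refine ⟨columnsToCoext R M fun k j => g (c k j), ?_⟩
    refine (columnsToCoext_naturality f _).symm.trans (congrArg _ ?_)
    funext k j
    exact hg _

variable (R n) in
/-- The module of all columns is a direct summand of the coinduced module. -/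
noncomputable def columnRetract (M : ModuleCat.{u} A) (hn : 0 < n) :
    Retract (ModuleCat.of (UpperTriangular R n A) (Column n M)) ((coextDiag R n A).obj M) where
  -- Slot 0 contributes Col/m_0 = Col; the retraction reads the values on the first row of matrix
  -- units.
  i := ModuleCat.ofHom (columnsToCoext R M ∘ₗ
    LinearMap.single (UpperTriangular R n A) (fun _ : Fin (n + 1) => Column n M) 0)
  r := ModuleCat.ofHom
    { toFun := fun (φ : (coextDiag R n A).obj M) j => φ (unit R ⟨0, hn⟩ j : UpperTriangular R n A)
      map_add' := fun φ ψ => rfl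
      map_smul' := fun b φ => by
        funext j
        change φ (unit R ⟨0, hn⟩ j * b : UpperTriangular R n A) =
          ∑ l, b.1 j l • φ (unit R ⟨0, hn⟩ l : UpperTriangular R n A)
        refine (coext_apply_eq_sum (M := M) φ _).trans ?_
        rw [Finset.sum_eq_single ⟨0, hn⟩]
        · refine Finset.sum_congr rfl fun l _ => ?_
          rw [unit_mul_apply b (Nat.zero_le _), if_pos rfl]; rfl
        · intro i _ hi
          refine Finset.sum_eq_zero fun l _ => ?_
          rw [unit_mul_apply b (Nat.zero_le _), if_neg hi, zero_smul]
        · simp }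
  retract := by
    refine ModuleCat.hom_ext (LinearMap.ext fun x => ?_)
    funext j
    exact columnsToCoext_unit M _ (i := ⟨0, hn⟩) (Nat.zero_le _)

end CoinductionSequence

/-! ### Injective dimension, self-extensions and finite generation of m(T). -/

section Homological

variable (R : Type u) (n : ℕ) {A : Type u} [CommRing R] [Ring A] [Algebra R A]
  (T : Type u) [AddCommGroup T] [Module A T]

theorem hasInjectiveDimensionLE_pi {B : Type u} [Ring B] {ι : Type} [Fintype ι] [DecidableEq ι]
    (M : Type u) [AddCommGroup M] [Module B M] (r : ℕ)
    (h : HasInjectiveDimensionLE (ModuleCat.of B M) r) :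
    HasInjectiveDimensionLE (ModuleCat.of B (ι → M)) r := by
  refine HasInjectiveDimensionLT.mk.{u} fun i hi Y e => ?_
  have := Abelian.Ext.subsingleton_of_id_eq_sum.{u} (X := Y) (Y := ModuleCat.of B (ι → M))
    (fun _ : ι => ModuleCat.of B M)
    (fun j => ModuleCat.ofHom (LinearMap.proj j))
    (fun j => ModuleCat.ofHom (LinearMap.single B (fun _ => M) j))
    (by
      ext x
      rw [ModuleCat.hom_sum]
      simp [Finset.sum_apply, Pi.single_apply])
    i (fun _ => HasInjectiveDimensionLT.subsingleton _ (r + 1) i hi Y)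
  exact Subsingleton.elim _ _

theorem hasInjectiveDimensionLE_succ_of_exact {B : Type u} [Ring B] {X Y Z : ModuleCat.{u} B}
    (f : X ⟶ Y) (g : Y ⟶ Z) (hf : Function.Injective f) (hg : Function.Surjective g)
    (hfg : Function.Exact f g) (r : ℕ) (hY : HasInjectiveDimensionLE Y r)
    (hZ : HasInjectiveDimensionLE Z r) : HasInjectiveDimensionLE X (r + 1) := by
  let S : ShortComplex (ModuleCat.{u} B) := ShortComplex.mk f g
    (ModuleCat.hom_ext (LinearMap.ext fun x => hfg.apply_apply_eq_zero x))
  have hS : S.ShortExact :=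
    { exact := (ShortComplex.ShortExact.moduleCat_exact_iff_function_exact S).2 hfg
      mono_f := (ModuleCat.mono_iff_injective _).2 hf
      epi_g := (ModuleCat.epi_iff_surjective _).2 hg }
  exact hS.hasInjectiveDimensionLT_X₁ (r + 1) hZ
    (hasInjectiveDimensionLT_of_ge _ (r + 1) _ (Nat.le_succ _))

theorem hasInjectiveDimensionLE_mSum (hn : 0 < n) (r : ℕ)
    (h : HasInjectiveDimensionLE (ModuleCat.of A T) r) :
    HasInjectiveDimensionLE (ModuleCat.of (UpperTriangular R n A) (MSum R n A T)) (r + 1) := by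
  have hZ : HasInjectiveDimensionLE ((coextDiag R n A).obj (ModuleCat.of A T)) r :=
    (ModuleCat.restrictCoextendScalarsAdj.{u, u, u}
      (diag R n (A := A))).hasInjectiveDimensionLE_rightAdjoint_obj _ r h
  have hC : HasInjectiveDimensionLE (ModuleCat.of (UpperTriangular R n A) (Column n T)) r :=
    (columnRetract R n (ModuleCat.of A T) hn).hasInjectiveDimensionLT (r + 1)
  let f : ModuleCat.of (UpperTriangular R n A) (MSum R n A T) ⟶
      ModuleCat.of (UpperTriangular R n A) (Fin (n + 1) → Column n T) :=
    ModuleCat.ofHom (MSum.toColumns R n (A := A) T)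
  let g : ModuleCat.of (UpperTriangular R n A) (Fin (n + 1) → Column n T) ⟶
      (coextDiag R n A).obj (ModuleCat.of A T) :=
    ModuleCat.ofHom (columnsToCoext R (n := n) (ModuleCat.of A T))
  have hf : Function.Injective f := MSum.toColumns_injective T
  have hg : Function.Surjective g := columnsToCoext_surjective (ModuleCat.of A T)
  have hfg : Function.Exact f g := exact_toColumns_columnsToCoext (ModuleCat.of A T)
  have hY := hasInjectiveDimensionLE_pi (ι := Fin (n + 1)) (Column n T) r hC
  exact hasInjectiveDimensionLE_succ_of_exact f g hf hg hfg r hY hZ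

variable (A) in
/-- The coordinate functions of `m(M)`, as linear maps over `A`. -/
noncomputable def entryMor (i j : Fin n) :
    (resDiag R n A).obj (ModuleCat.of _ (MSum R n A T)) ⟶ ModuleCat.of A T :=
  ModuleCat.ofHom (X := (resDiag R n A).obj (ModuleCat.of _ (MSum R n A T)))
    { toFun := fun x => MSum.entry (show MSum R n A T from x) i j
      map_add' := fun _ _ => rfl
      map_smul' := fun a x => MSum.entry_diag_smul a x i j }

variable (A) in
/-- The coordinate inclusions of `m(M)`, as linear maps over `A`. -/
noncomputable def singleMor (i j : Fin n) :
    ModuleCat.of A T ⟶ (resDiag R n A).obj (ModuleCat.of _ (MSum R n A T)) :=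
  ModuleCat.ofHom (Y := (resDiag R n A).obj (ModuleCat.of _ (MSum R n A T)))
    { toFun := fun p => (unit R j i : UpperTriangular R n A) • MSum.gen R A i p
      map_add' := fun p q => by rw [MSum.gen_add, smul_add]; rfl
      map_smul' := fun a p => by
        rw [MSum.gen_smul, smul_smul, unit_mul_diag, ← smul_smul]; rfl }

/-- The adjunction reduces the claim to extensions over A of T by the restriction of m(T), whose
identity is a sum of maps through T, one for each entry. -/
theorem subsingleton_ext_mSum (i : ℕ)
    (h : Subsingleton (Abelian.Ext.{u} (ModuleCat.of A T) (ModuleCat.of A T) (i + 1))) :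
    Subsingleton (Abelian.Ext.{u} (ModuleCat.of (UpperTriangular R n A) (MSum R n A T))
      (ModuleCat.of (UpperTriangular R n A) (MSum R n A T)) (i + 1)) := by
  refine (mAdjunction R n A).subsingleton_ext_leftAdjoint_obj (ModuleCat.of A T) _ i ?_
  refine Abelian.Ext.subsingleton_of_id_eq_sum (ι := Fin n × Fin n)
    (fun _ => ModuleCat.of A T) (fun k => entryMor R n A T k.1 k.2)
    (fun k => singleMor R n A T k.1 k.2) ?_ _ (fun _ => h)
  refine ModuleCat.hom_ext (LinearMap.ext fun x => ?_)
  rw [ModuleCat.hom_sum, LinearMap.sum_apply, Fintype.sum_prod_type]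
  exact MSum.eq_sum_unit_smul_gen (R := R) (A := A) (M := T) x

/-- Everything is finite already over R: each m_i(T) is an R-submodule of a finite power of T, and R
is noetherian. -/
theorem finite_mSum [IsNoetherianRing R] [Module.Finite R A] [Module R T] [IsScalarTower R A T]
    [Module.Finite A T] : Module.Finite (UpperTriangular R n A) (MSum R n A T) := by
  have : Module.Finite R T := Module.Finite.trans A T
  have : Module.Finite R (Column n T) := inferInstanceAs (Module.Finite R (Fin n → T))
  have (i : Fin n) : Module.Finite R (mBranch R n A T i) :=
    inferInstanceAs (Module.Finite R ((mBranch R n A T i).restrictScalars R))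
  exact Module.Finite.of_restrictScalars_finite R _ _

end Homological

/-! ### Closure properties of add(T). -/

section AddClosure

variable {B T : Type u} [Ring B] [AddCommGroup T] [Module B T]

theorem IsInAdd.of_fintype {X : Type u} [AddCommGroup X] [Module B X] {ι : Type*} [Fintype ι]
    (i : X →ₗ[B] (ι → T)) (p : (ι → T) →ₗ[B] X) (h : p ∘ₗ i = LinearMap.id) : IsInAdd B T X := by
  let e := Fintype.equivFin ι
  refine ⟨Fintype.card ι, LinearMap.funLeft B T e.symm ∘ₗ i, p ∘ₗ LinearMap.funLeft B T e, ?_⟩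
  rw [← h]
  ext x
  simp only [LinearMap.comp_apply]
  congr 1
  ext k
  simp [LinearMap.funLeft_apply]

theorem IsInAdd.of_retract {X Y : Type u} [AddCommGroup X] [Module B X] [AddCommGroup Y]
    [Module B Y] (hY : IsInAdd B T Y) (i : X →ₗ[B] Y) (p : Y →ₗ[B] X)
    (h : p ∘ₗ i = LinearMap.id) : IsInAdd B T X := by
  obtain ⟨m, j, q, hq⟩ := hY
  refine ⟨m, j ∘ₗ i, p ∘ₗ q, ?_⟩
  rw [LinearMap.comp_assoc, ← LinearMap.comp_assoc i, hq, LinearMap.id_comp, h]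

theorem IsInAdd.pi {Y : Type u} [AddCommGroup Y] [Module B Y] {ι : Type} [Fintype ι]
    (hY : IsInAdd B T Y) : IsInAdd B T (ι → Y) := by
  obtain ⟨m, j, q, hq⟩ := hY
  refine IsInAdd.of_fintype (ι := ι × Fin m)
    (LinearMap.pi fun k => LinearMap.proj k.2 ∘ₗ j ∘ₗ LinearMap.proj k.1)
    (LinearMap.pi fun k => q ∘ₗ LinearMap.funLeft B T (Prod.mk k)) ?_
  refine LinearMap.ext fun x => funext fun k => ?_
  exact LinearMap.congr_fun hq (x k)

theorem IsInAdd.prod {X Y : Type u} [AddCommGroup X] [Module B X] [AddCommGroup Y]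
    [Module B Y] (hX : IsInAdd B T X) (hY : IsInAdd B T Y) : IsInAdd B T (X × Y) := by
  obtain ⟨m, i, p, hp⟩ := hX
  obtain ⟨l, j, q, hq⟩ := hY
  refine IsInAdd.of_fintype (ι := Fin m ⊕ Fin l)
    (LinearMap.pi (Sum.rec (fun k => LinearMap.proj k ∘ₗ i ∘ₗ LinearMap.fst B X Y)
      fun k => LinearMap.proj k ∘ₗ j ∘ₗ LinearMap.snd B X Y))
    ((p ∘ₗ LinearMap.funLeft B T Sum.inl).prod (q ∘ₗ LinearMap.funLeft B T Sum.inr)) ?_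
  refine LinearMap.ext fun x => Prod.ext ?_ ?_
  · exact LinearMap.congr_fun hp x.1
  · exact LinearMap.congr_fun hq x.2

theorem IsInAdd.of_subsingleton (X : Type u) [AddCommGroup X] [Module B X] [Subsingleton X] :
    IsInAdd B T X :=
  ⟨0, 0, 0, LinearMap.ext fun _ => Subsingleton.elim _ _⟩

end AddClosure

/-! ### Resolving a cokernel by a mapping cone. -/

section Cone

variable {B : Type u} [Ring B] (X X' : ℕ → ModuleCat.{u} B)

/-- The terms of the mapping cone of a morphism of complexes from `X'` to `X`. -/
def coneObj : ℕ → ModuleCat.{u} B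
  | 0 => X 0
  | i + 1 => ModuleCat.of B (X (i + 1) × X' i)

variable {X X'}

/-- The differential of the mapping cone of a morphism `g` of complexes. -/
def coneD (d : ∀ i, X (i + 1) →ₗ[B] X i) (d' : ∀ i, X' (i + 1) →ₗ[B] X' i)
    (g : ∀ i, X' i →ₗ[B] X i) : ∀ i, coneObj X X' (i + 1) →ₗ[B] coneObj X X' i
  | 0 => (d 0).coprod (g 0)
  | i + 1 => ((d (i + 1)).coprod (g (i + 1))).prod (-(d' i ∘ₗ LinearMap.snd B _ _))

/-- Given 0 → K → L → D → 0 and a chain map g over ι between resolutions of K and L, the cone of g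
resolves D, with length one more. -/
theorem HasAddResolution.cone {T K L D : Type u} [AddCommGroup T] [Module B T] [AddCommGroup K]
    [Module B K] [AddCommGroup L] [Module B L] [AddCommGroup D] [Module B D] {s : ℕ}
    {d : ∀ i, X (i + 1) →ₗ[B] X i} {d' : ∀ i, X' (i + 1) →ₗ[B] X' i}
    {ε : X 0 →ₗ[B] L} {ε' : X' 0 →ₗ[B] K} {ι : K →ₗ[B] L} {π : L →ₗ[B] D}
    (hX : ∀ i ≤ s, IsInAdd B T (X i)) (hX' : ∀ i ≤ s, IsInAdd B T (X' i))
    (hs : ∀ i, s < i → Subsingleton (X i)) (hs' : ∀ i, s < i → Subsingleton (X' i))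
    (hε : Function.Surjective ε) (hε' : Function.Surjective ε')
    (hdε : Function.Exact (d 0) ε) (hdε' : Function.Exact (d' 0) ε')
    (hd : ∀ i, Function.Exact (d (i + 1)) (d i)) (hd' : ∀ i, Function.Exact (d' (i + 1)) (d' i))
    (g : ∀ i, X' i →ₗ[B] X i) (hg : ∀ i x, g i (d' i x) = d i (g (i + 1) x))
    (hgε : ∀ x, ε (g 0 x) = ι (ε' x)) (hι : Function.Injective ι) (hιπ : Function.Exact ι π)
    (hπ : Function.Surjective π) : HasAddResolution B T D := by
  refine ⟨s + 1, coneObj X X', coneD d d' g, π ∘ₗ ε, ?_, ?_, hπ.comp hε, ?_, ?_⟩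
  · rintro (_ | i) hi
    · exact hX 0 (Nat.zero_le _)
    · refine IsInAdd.prod ?_ (hX' i (Nat.le_of_succ_le_succ hi))
      -- In the top degree i = s, the factor X (s + 1) lies beyond the resolution and is zero.
      rcases Nat.lt_or_ge s (i + 1) with h | h
      · have := hs _ h
        exact IsInAdd.of_subsingleton _
      · exact hX _ h
  · rintro (_ | i) hi
    · omega
    · have := hs (i + 1) (by omega)
      have := hs' i (by omega)
      exact inferInstanceAs (Subsingleton (X (i + 1) × X' i))
  · intro (x : X 0)
    constructor
    · intro hx
      obtain ⟨k, hk⟩ := (hιπ (ε x)).1 hx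
      obtain ⟨y', rfl⟩ := hε' k
      obtain ⟨y, hy⟩ := (hdε (x - g 0 y')).1 (by rw [map_sub, hgε, hk, sub_self])
      refine ⟨((y, y') : X 1 × X' 0), ?_⟩
      change d 0 y + g 0 y' = x
      rw [hy, sub_add_cancel]
    · rintro ⟨⟨y, y'⟩, rfl⟩
      change π (ε (d 0 y + g 0 y')) = 0
      rw [map_add, hdε.apply_apply_eq_zero, zero_add, hgε, hιπ.apply_apply_eq_zero]
  -- Once x' is a boundary d' y', adding g y' turns x into a cycle of X, hence a boundary. The
  -- preimage in the cone is (y, -y'), by the sign of d' there.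
  · have key (i : ℕ) (x : X (i + 1)) (x' : X' i) (y' : X' (i + 1)) (hy' : d' i y' = x')
        (h : d i x + g i x' = 0) : ∃ y : X (i + 1 + 1), d (i + 1) y - g (i + 1) y' = x := by
      obtain ⟨y, hy⟩ := (hd i (x + g (i + 1) y')).1 (by rw [map_add, ← hg, hy', h])
      exact ⟨y, by rw [hy, add_sub_cancel_right]⟩
    rintro (_ | i) ⟨x, x'⟩
    · constructor
      · intro (h : d 0 x + g 0 x' = 0)
        -- In the lowest degree no equation d' x' = 0 is available; instead ι (ε' x') = ε (g x') =
        -- -ε (d x) = 0, and ι is injective.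
        obtain ⟨y', hy'⟩ := (hdε' x').1 (hι (by
          rw [← hgε, map_zero, ← map_zero ε, ← h, map_add, hdε.apply_apply_eq_zero, zero_add]))
        obtain ⟨y, hy⟩ := key 0 x x' y' hy' h
        refine ⟨((y, -y') : X 2 × X' 1), Prod.ext ?_ ?_⟩
        · change d 1 y + g 1 (-y') = x
          rw [map_neg, ← sub_eq_add_neg, hy]
        · change -d' 0 (-y') = x'
          rw [map_neg, neg_neg, hy']
      · rintro ⟨⟨y, y'⟩, hy⟩
        obtain ⟨rfl, rfl⟩ := Prod.mk.inj hy
        change d 0 (d 1 y + g 1 y') + g 0 (-d' 0 y') = 0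
        rw [map_add, map_neg, hg, (hd 0).apply_apply_eq_zero, zero_add, add_neg_cancel]
    · constructor
      · intro h
        obtain ⟨h₁, h₂⟩ := Prod.mk.inj h
        replace h₁ : d (i + 1) x + g (i + 1) x' = 0 := h₁
        replace h₂ : -d' i x' = 0 := h₂
        obtain ⟨y', hy'⟩ := (hd' i x').1 (neg_eq_zero.1 h₂)
        obtain ⟨y, hy⟩ := key (i + 1) x x' y' hy' h₁
        refine ⟨((y, -y') : X (i + 3) × X' (i + 2)), Prod.ext ?_ ?_⟩
        · change d (i + 2) y + g (i + 2) (-y') = x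
          rw [map_neg, ← sub_eq_add_neg, hy]
        · change -d' (i + 1) (-y') = x'
          rw [map_neg, neg_neg, hy']
      · rintro ⟨⟨y, y'⟩, hy⟩
        obtain ⟨rfl, rfl⟩ := Prod.mk.inj hy
        refine Prod.ext ?_ ?_
        · change d (i + 1) (d (i + 2) y + g (i + 2) y') + g (i + 1) (-d' (i + 1) y') = 0
          rw [map_add, map_neg, hg, (hd (i + 1)).apply_apply_eq_zero, zero_add, add_neg_cancel]
        · change -d' i (-d' (i + 1) y') = 0
          rw [map_neg, neg_neg, (hd' i).apply_apply_eq_zero]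

end Cone

/-! ### The resolution of the dual of the triangular matrix algebra. -/

section DualResolution

variable {R : Type u} {n : ℕ} {A : Type u} [CommRing R] [Ring A] [Algebra R A]

namespace Column

variable (R n) in
/-- The entrywise application of a linear map to tuples of columns. -/
def powMap {M N : Type u} [AddCommGroup M] [Module A M] [AddCommGroup N] [Module A N]
    (f : M →ₗ[A] N) :
    (Fin (n + 1) → Column n M) →ₗ[UpperTriangular R n A] (Fin (n + 1) → Column n N) where
  toFun c k := map R n f (c k)
  map_add' c c' := funext fun k => map_add (map R n f) (c k) (c' k)
  map_smul' b c := funext fun k => map_smul (map R n f) b (c k)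

variable {M N P : Type u} [AddCommGroup M] [Module A M] [AddCommGroup N] [Module A N]
  [AddCommGroup P] [Module A P] {f : M →ₗ[A] N} {g : N →ₗ[A] P}

theorem powMap_surjective (hf : Function.Surjective f) :
    Function.Surjective (powMap R n f) := by
  intro c
  choose h hh using hf
  exact ⟨fun k j => h (c k j), funext fun k => funext fun j => hh _⟩

theorem powMap_exact (hfg : Function.Exact f g) :
    Function.Exact (powMap R n f) (powMap R n g) := by
  intro c
  constructor
  · intro h
    have h' (k : Fin (n + 1)) (j : Fin n) : ∃ x, f x = c k j :=
      (hfg _).1 (congrFun (congrFun h k) j)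
    choose x hx using h'
    exact ⟨x, funext fun k => funext fun j => hx k j⟩
  · rintro ⟨c, rfl⟩
    exact funext fun k => funext fun j => hfg.apply_apply_eq_zero _

end Column

namespace MSum

variable {M N P : Type u} [AddCommGroup M] [Module A M] [AddCommGroup N] [Module A N]
  [AddCommGroup P] [Module A P] {f : M →ₗ[A] N} {g : N →ₗ[A] P}

theorem map_surjective (hf : Function.Surjective f) : Function.Surjective (map R n f) := by
  intro x
  choose h hh using hf
  refine ⟨mk (fun i j => if i < j then 0 else h (entry x i j)) fun i j hij => if_pos hij, ?_⟩
  ext i j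
  rw [entry_map, entry_mk]
  split_ifs with hij
  · rw [map_zero, entry_of_lt x hij]
  · exact hh _

theorem map_exact (hfg : Function.Exact f g) : Function.Exact (map R n f) (map R n g) := by
  intro x
  constructor
  · intro h
    have h' (i j : Fin n) : ∃ y, f y = entry x i j :=
      (hfg _).1 (congrArg (fun z => entry z i j) h)
    choose y hy using h'
    refine ⟨mk (fun i j => if i < j then 0 else y i j) fun i j hij => if_pos hij, ?_⟩
    ext i j
    rw [entry_map, entry_mk]
    split_ifs with hij
    · rw [map_zero, entry_of_lt x hij]
    · exact hy i j
  · rintro ⟨y, rfl⟩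
    exact ext fun i j => hfg.apply_apply_eq_zero _

theorem toColumns_map (f : M →ₗ[A] N) (x : MSum R n A M) :
    toColumns R n N (map R n f x) = Column.powMap R n f (toColumns R n M x) := by
  funext k
  refine Fin.cases ?_ (fun i => rfl) k
  exact (map_zero (Column.map R n f)).symm

end MSum

theorem IsInAdd.mSum {T X : Type u} [AddCommGroup T] [Module A T] [AddCommGroup X] [Module A X]
    (h : IsInAdd A T X) : IsInAdd (UpperTriangular R n A) (MSum R n A T) (MSum R n A X) := by
  obtain ⟨m, i, p, hp⟩ := h
  refine ⟨m, LinearMap.pi fun k => MSum.map R n (LinearMap.proj k ∘ₗ i),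
    ∑ k, MSum.map R n (p ∘ₗ LinearMap.single A (fun _ => T) k) ∘ₗ LinearMap.proj k, ?_⟩
  refine LinearMap.ext fun x => MSum.ext fun a b => ?_
  rw [LinearMap.comp_apply, LinearMap.sum_apply, MSum.entry_sum]
  change ∑ k, p (Pi.single k (i (MSum.entry x a b) k)) = MSum.entry x a b
  rw [← map_sum, Finset.univ_sum_single]
  exact LinearMap.congr_fun hp _

/-- The last summand m_n(X), at index n - 1, imposes no condition and is the module of all columns.
Hence columns over add(T) lie in add(m(T)). -/
theorem exists_column_retract_mSum (hn : 0 < n) (X : Type u) [AddCommGroup X] [Module A X] :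
    ∃ (i : Column n X →ₗ[UpperTriangular R n A] MSum R n A X)
      (p : MSum R n A X →ₗ[UpperTriangular R n A] Column n X), p ∘ₗ i = LinearMap.id := by
  have hlast (j : Fin n) : ¬ (⟨n - 1, Nat.sub_lt hn Nat.one_pos⟩ : Fin n) < j := by
    rw [Fin.lt_def]
    change ¬ n - 1 < j.1
    omega
  refine ⟨LinearMap.single _ (fun i => mBranch R n A X i) ⟨n - 1, Nat.sub_lt hn Nat.one_pos⟩ ∘ₗ
    LinearMap.codRestrict _ LinearMap.id fun x j hj => absurd hj (hlast j),
    Submodule.subtype _ ∘ₗ LinearMap.proj ⟨n - 1, Nat.sub_lt hn Nat.one_pos⟩, ?_⟩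
  refine LinearMap.ext fun x => ?_
  simp only [LinearMap.comp_apply, LinearMap.proj_apply, LinearMap.single_apply, Pi.single_eq_same]
  rfl

/-- The isomorphism from the coinduction of `D(A)` to `D(T_n(A))`. -/
noncomputable def coextDualEquiv (R : Type u) (n : ℕ) (A E : Type u) [CommRing R] [Ring A]
    [Algebra R A] [AddCommGroup E] [Module R E] :
    (coextDiag R n A).obj (ModuleCat.of A (DualRegular R A E)) ≃ₗ[UpperTriangular R n A]
      DualRegular R (UpperTriangular R n A) E where
  toFun φ := show UpperTriangular R n A →ₗ[R] E from
    -- Tensor-hom adjunction: Hom_A(B, Hom_R(A, E)) ≅ Hom_R(B, E) by evaluation at 1, with inverse ψ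
    -- ↦ (b ↦ (a ↦ ψ(ab))).
    { toFun := fun b => (show A →ₗ[R] E from φ b) 1
      map_add' := fun b c => by rw [coext_add]; rfl
      map_smul' := fun r b => by
        have h : r • b = diag R n (algebraMap R A r) * b := by
          ext i j
          rw [diag_mul_apply, ← Algebra.smul_def]
          rfl
        rw [h, coext_diag_mul]
        change (show A →ₗ[R] E from φ b) (1 * algebraMap R A r) = r • (show A →ₗ[R] E from φ b) 1
        rw [one_mul, Algebra.algebraMap_eq_smul_one, map_smul] }
  map_add' φ ψ := rfl
  map_smul' b φ := rfl
  invFun ψ := coextMk (ModuleCat.of A (DualRegular R A E))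
    { toFun := fun b => show A →ₗ[R] E from
        { toFun := fun a => (show UpperTriangular R n A →ₗ[R] E from ψ) (diag R n a * b)
          map_add' := fun a a' => by rw [map_add, add_mul, map_add]
          map_smul' := fun r a => by
            rw [RingHom.id_apply, ← map_smul]
            congr 1
            ext i j
            rw [diag_mul_apply, smul_mul_assoc]
            change _ = r • (diag R n a * b).1 i j
            rw [diag_mul_apply] }
      map_zero' := LinearMap.ext fun a => by
        change (show UpperTriangular R n A →ₗ[R] E from ψ) (diag R n a * 0) = 0
        rw [mul_zero, map_zero]
      map_add' := fun b c => LinearMap.ext fun a => by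
        change (show UpperTriangular R n A →ₗ[R] E from ψ) (diag R n a * (b + c)) = _
        rw [mul_add, map_add]
        rfl }
    fun a b => LinearMap.ext fun a' => by
      change (show UpperTriangular R n A →ₗ[R] E from ψ) (diag R n a' * (diag R n a * b)) =
        (show UpperTriangular R n A →ₗ[R] E from ψ) (diag R n (a' * a) * b)
      rw [map_mul (diag R n), mul_assoc]
  left_inv φ := coext_ext fun b => LinearMap.ext fun a => by
    change (show A →ₗ[R] E from φ (diag R n a * b)) 1 = (show A →ₗ[R] E from φ b) a
    rw [coext_diag_mul]
    change (show A →ₗ[R] E from φ b) (1 * a) = _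
    rw [one_mul]
  right_inv ψ := LinearMap.ext fun b => by
    change (show UpperTriangular R n A →ₗ[R] E from ψ) (diag R n 1 * b) = _
    rw [map_one, one_mul]

/-- Applied to a resolution of D(A), the exact functors m and Col^(n+1) resolve the first two terms
of the coinduction sequence, and naturality of `MSum.toColumns` supplies the chain map. The third
term is identified with the dual of B by `coextDualEquiv`. -/
theorem hasAddResolution_mSum (hn : 0 < n) {T E : Type u} [AddCommGroup T] [Module A T]
    [AddCommGroup E] [Module R E] (h : HasAddResolution A T (DualRegular R A E)) :
    HasAddResolution (UpperTriangular R n A) (MSum R n A T)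
      (DualRegular R (UpperTriangular R n A) E) := by
  obtain ⟨s, X, d, ε, hX, hs, hε, hdε, hd⟩ := h
  refine HasAddResolution.cone (s := s)
    (X := fun i => ModuleCat.of (UpperTriangular R n A) (Fin (n + 1) → Column n (X i)))
    (X' := fun i => ModuleCat.of (UpperTriangular R n A) (MSum R n A (X i)))
    (d := fun i => Column.powMap R n (d i)) (d' := fun i => MSum.map R n (d i))
    (ε := Column.powMap R n ε) (ε' := MSum.map R n ε)
    (ι := MSum.toColumns R n (DualRegular R A E))
    (π := (coextDualEquiv R n A E).toLinearMap ∘ₗ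
      columnsToCoext R (ModuleCat.of A (DualRegular R A E)))
    (fun i hi => ?_) (fun i hi => (hX i hi).mSum)
    (fun i hi => ?_) (fun i hi => ?_)
    (Column.powMap_surjective hε) (MSum.map_surjective hε)
    (Column.powMap_exact hdε) (MSum.map_exact hdε)
    (fun i => Column.powMap_exact (hd i)) (fun i => MSum.map_exact (hd i))
    (fun i => MSum.toColumns R n (X i)) (fun i x => MSum.toColumns_map (d i) x)
    (fun x => (MSum.toColumns_map ε x).symm) (MSum.toColumns_injective _) ?_ ?_
  · obtain ⟨j, p, hjp⟩ := exists_column_retract_mSum (R := R) (A := A) hn (X i)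
    exact ((hX i hi).mSum.of_retract j p hjp).pi
  · have := hs i hi
    exact ⟨fun x y => funext fun k => funext fun j => Subsingleton.elim (α := X i) _ _⟩
  · have := hs i hi
    exact ⟨fun x y => MSum.ext fun k j => Subsingleton.elim (α := X i) _ _⟩
  · intro c
    rw [← exact_toColumns_columnsToCoext (ModuleCat.of A (DualRegular R A E)) c]
    exact (coextDualEquiv R n A E).map_eq_zero_iff
  · exact (coextDualEquiv R n A E).surjective.comp (columnsToCoext_surjective _)

end DualResolution

/-! ### The endomorphism algebra of m(T). -/

section Endomorphisms

variable {R : Type u} {n : ℕ} {A : Type u} [CommRing R] [Ring A] [Algebra R A]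
  {T : Type u} [AddCommGroup T] [Module A T] [Module R T] [IsScalarTower R A T]

/-- The endomorphism of `m(T)` whose component `m_i(T) → m_j(T)` is the entrywise application of
the entry of a triangular matrix in position `(n + 1 - j, n + 1 - i)`. -/
def MSum.endOfTriangular (u : UpperTriangular R n (Module.End A T)) :
    Module.End (UpperTriangular R n A) (MSum R n A T) where
  -- Components m_i → m_j must vanish for j < i, which in position (j, i) is lower triangular.
  -- Reversing both indices makes it upper triangular and keeps the order of products, so no
  -- opposite ring appears.
  toFun x := mk (fun j l => ∑ i, u.1 j.rev i.rev (entry x i l)) fun j l hjl => by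
    refine Finset.sum_eq_zero fun i _ => ?_
    rcases le_or_gt i j with hij | hij
    · rw [entry_of_lt x (lt_of_le_of_lt hij hjl), map_zero]
    · rw [u.2 _ _ (Fin.rev_lt_rev.2 hij), LinearMap.zero_apply]
  map_add' x y := ext fun j l => by
    change ∑ i, u.1 j.rev i.rev (entry x i l + entry y i l) =
      ∑ i, u.1 j.rev i.rev (entry x i l) + ∑ i, u.1 j.rev i.rev (entry y i l)
    simp only [map_add, Finset.sum_add_distrib]
  map_smul' b x := ext fun j l => by
    change ∑ i, u.1 j.rev i.rev (∑ k, b.1 l k • entry x i k) =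
      ∑ k, b.1 l k • ∑ i, u.1 j.rev i.rev (entry x i k)
    simp only [map_sum, map_smul, Finset.smul_sum]
    exact Finset.sum_comm

theorem MSum.entry_endOfTriangular (u : UpperTriangular R n (Module.End A T)) (x : MSum R n A T)
    (j l : Fin n) :
    entry (endOfTriangular u x) j l = ∑ i, u.1 j.rev i.rev (entry x i l) := rfl

theorem MSum.entry_endOfTriangular_gen (u : UpperTriangular R n (Module.End A T)) (i : Fin n)
    (p : T) (j l : Fin n) :
    entry (endOfTriangular u (gen R A i p)) j l = if l = i then u.1 j.rev i.rev p else 0 := by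
  rw [entry_endOfTriangular, Finset.sum_eq_single i]
  · rw [entry_gen]
    by_cases h : l = i <;> simp [h]
  · intro k _ hk
    simp [entry_gen, hk]
  · simp

variable (R n A T) in
/-- `MSum.endOfTriangular` as a homomorphism of `R`-algebras. -/
def MSum.endAlgHom :
    UpperTriangular R n (Module.End A T) →ₐ[R]
      Module.End (UpperTriangular R n A) (MSum R n A T) :=
  AlgHom.ofLinearMap
    { toFun := endOfTriangular
      map_add' := fun u v => LinearMap.ext fun x => ext fun j l => by
        change ∑ i, (u.1 j.rev i.rev (entry x i l) + v.1 j.rev i.rev (entry x i l)) =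
          ∑ i, u.1 j.rev i.rev (entry x i l) + ∑ i, v.1 j.rev i.rev (entry x i l)
        exact Finset.sum_add_distrib
      map_smul' := fun r u => LinearMap.ext fun x => ext fun j l => by
        change ∑ i, r • u.1 j.rev i.rev (entry x i l) = r • ∑ i, u.1 j.rev i.rev (entry x i l)
        rw [Finset.smul_sum] }
    (LinearMap.ext fun x => ext fun j l => by
      change ∑ i, (1 : Matrix (Fin n) (Fin n) (Module.End A T)) j.rev i.rev (entry x i l) = _
      rw [Finset.sum_eq_single j]
      · rw [Matrix.one_apply_eq]; rfl
      · intro i _ hi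
        rw [Matrix.one_apply_ne (fun h => hi (Fin.rev_injective h).symm), LinearMap.zero_apply]
      · simp)
    fun u v => LinearMap.ext fun x => ext fun j l => by
      change ∑ i, (u * v).1 j.rev i.rev (entry x i l) =
        ∑ k : Fin n, u.1 j.rev k.rev (∑ i, v.1 k.rev i.rev (entry x i l))
      simp only [UpperTriangular.mul_apply, LinearMap.sum_apply, map_sum, Module.End.mul_apply]
      rw [Finset.sum_comm]
      exact (Equiv.sum_comp Fin.revPerm fun k =>
        ∑ i, u.1 j.rev k (v.1 k i.rev (entry x i l))).symm

/-- An endomorphism is determined on the generators in row i of m_i(T). These are fixed by the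
idempotent at (i, i), so their images lie in row i, and row i of m_j(T) is zero for j < i. -/
theorem MSum.endAlgHom_bijective : Function.Bijective (endAlgHom R n A T) := by
  constructor
  · intro u v h
    refine UpperTriangular.ext fun a b => LinearMap.ext fun p => ?_
    have := congrArg (fun f : Module.End _ _ => entry (f (gen R A b.rev p)) a.rev b.rev) h
    change entry (endOfTriangular u _) _ _ = entry (endOfTriangular v _) _ _ at this
    simpa only [entry_endOfTriangular_gen, if_true, Fin.rev_rev] using this
  · intro g
    refine ⟨⟨Matrix.of fun a b =>
      { toFun := fun p => entry (g (gen R A b.rev p)) a.rev b.rev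
        map_add' := fun p q => by rw [gen_add, map_add, entry_add]
        map_smul' := fun a p => by rw [gen_smul, map_smul, entry_diag_smul]; rfl },
      fun a b hab => LinearMap.ext fun p => entry_of_lt _ (Fin.rev_lt_rev.2 hab)⟩, ?_⟩
    refine hom_ext fun i p => ext fun j l => ?_
    refine (entry_endOfTriangular_gen _ i p j l).trans ?_
    split_ifs with h
    · subst h
      change entry (g (gen R A l.rev.rev p)) j.rev.rev l.rev.rev = _
      simp only [Fin.rev_rev]
    · rw [← unit_smul_incl, map_smul, entry_unit_smul, if_neg fun h' => h h'.2]

end Endomorphisms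

end TriangularModules

theorem lemma3p7 (R A : Type u) [CommRing R] [IsArtinianRing R] [Ring A] [Algebra R A]
    [Module.Finite R A] (n : ℕ) (hn : 2 ≤ n) (r : ℕ)
    (T : Type u) [AddCommGroup T] [Module A T] [Module R T] [IsScalarTower R A T]
    (hT : IsCotilting R A r T) :
    IsCotilting R (UpperTriangular R n A) (r + 1) (MSum R n A T) ∧
      Nonempty (Module.End (UpperTriangular R n A) (MSum R n A T) ≃ₐ[R]
        UpperTriangular R n (Module.End A T)) := by
  have hn' : 0 < n := by omega
  refine ⟨⟨?_, ?_, ?_, ?_⟩, ⟨(AlgEquiv.ofBijective (MSum.endAlgHom R n A T)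
    MSum.endAlgHom_bijective).symm⟩⟩
  · have := hT.finite
    exact finite_mSum R n T
  · exact hasInjectiveDimensionLE_mSum R n T hn' r hT.injDim_le
  · intro i hi
    obtain ⟨i, rfl⟩ := Nat.exists_eq_add_of_le' hi
    exact subsingleton_ext_mSum R n T i (hT.ext_self (i + 1) hi)
  · obtain ⟨E, _, _, hE, h⟩ := hT.resolution
    exact ⟨E, _, _, hE, hasAddResolution_mSum hn' h⟩
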